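/- Let $n\ge 1$ be an integer, let $S^{n-1}=\{\ell\in\mathbb{R}^n:\|\ell\|=1\}$ be the Euclidean unit sphere, and for $x\in\mathbb{R}^n$ put $$\Phi_n(x)=\mathbb{E}_{\ell\sim S^{n-1}}\, e^{\langle \ell,x\rangle},$$ where $\ell$ is uniformly distributed on $S^{n-1}$ (normalized surface measure; for $n=1$, $\ell=\pm1$ with probability $\tfrac12$ each). Thus $\Phi_n(\lambda X)=\mathbb{E}_{\ell\sim S^{n-1}}\, e^{\lambda\langle \ell,X\rangle}$ for $\lambda\in\mathbb{R}$ and $X\in\mathbb{R}^n$. Then for every $X\in\mathbb{R}^n$, every $\lambda\in\mathbb{R}$ and every $\varepsilon\in(0,1)$, $$\Phi_n(\lambda X)\ \ge\ (1-\varepsilon^2)^{n/2}\, e^{\varepsilon\|\lambda X\|},$$ where $\|\cdot\|$ is the Euclidean norm. -/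

import Mathlib

open MeasureTheory

/-- The uniform probability distribution on the Euclidean unit sphere of `ℝⁿ` (for `1 ≤ n`): the
surface measure of the sphere, divided by its total mass. -/
noncomputable def sphereUniform (n : ℕ) :
    Measure (Metric.sphere (0 : EuclideanSpace ℝ (Fin n)) 1) :=
  ((volume : Measure (EuclideanSpace ℝ (Fin n))).toSphere Set.univ)⁻¹ •
    (volume : Measure (EuclideanSpace ℝ (Fin n))).toSphere

theorem isProbabilityMeasure_sphereUniform {n : ℕ} (hn : 1 ≤ n) :
    IsProbabilityMeasure (sphereUniform n) := by
  haveI : NeZero n := ⟨by omega⟩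
  refine ⟨?_⟩
  rw [sphereUniform, Measure.smul_apply, smul_eq_mul]
  refine ENNReal.inv_mul_cancel ?_ (measure_ne_top _ _)
  rw [Ne, Measure.measure_univ_eq_zero]
  exact Measure.toSphere_ne_zero _

/-- The energy function `Φ_n(x) = 𝔼_{ℓ ∼ S^{n-1}} exp ⟨ℓ, x⟩`, the expectation being over `ℓ`
uniformly distributed on the unit sphere of `ℝⁿ`. -/
noncomputable def energyPhi (n : ℕ) (x : EuclideanSpace ℝ (Fin n)) : ℝ :=
  ∫ l : Metric.sphere (0 : EuclideanSpace ℝ (Fin n)) 1,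
    Real.exp (inner ℝ (l : EuclideanSpace ℝ (Fin n)) x) ∂(sphereUniform n)

/-- `Φ_n(c X) = 𝔼_{ℓ ∼ S^{n-1}} exp (c ⟨ℓ, X⟩)`. -/
theorem energyPhi_smul (n : ℕ) (c : ℝ) (X : EuclideanSpace ℝ (Fin n)) :
    energyPhi n (c • X) =
      ∫ l : Metric.sphere (0 : EuclideanSpace ℝ (Fin n)) 1,
        Real.exp (c * inner ℝ (l : EuclideanSpace ℝ (Fin n)) X) ∂(sphereUniform n) := by
  simp only [energyPhi, inner_smul_right]

/-! `Φ_n(x)` equals `₀F₁(; n/2; ‖x‖²/4)`, and `log ₀F₁(; a; ·)` is concave on `[0, ∞)`. Hence `Φ_n(r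
x) ≤ Φ_n(x) exp(c (r² - 1))` for some `c > 0` and all `r` (`exists_energyPhi_smul_le`).

The Gaussian integral of `exp(⟨y, x⟩ - b ‖y‖²)` is explicit. Averaging over spheres replaces `exp
⟨y, x⟩` by `Φ_n(‖y‖ x)`, and the tangent bound leaves another Gaussian integral, of parameter `b -
c` (`exp_le_energyPhi_mul`). With `b = c / ε²` this reads `Φ_n(x) ≥ (1 - ε²)^(n/2) exp(c + ε² ‖x‖² /
(4c))`, and AM-GM bounds the exponent below by `ε ‖x‖`, whatever `c` is. -/

/-! ### The series `₀F₁` and its log-concavity -/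

/-- The confluent hypergeometric limit function `₀F₁(; a; v)`. -/
noncomputable def hypZeroOne (a v : ℝ) : ℝ :=
  ∑' k : ℕ, v ^ k / (k.factorial * (ascPochhammer ℝ k).eval a)

theorem min_le_ascPochhammer_eval {a : ℝ} (ha : 0 < a) (k : ℕ) :
    min a 1 ≤ (ascPochhammer ℝ k).eval a := by
  induction k with
  | zero => simp
  | succ k ih =>
    rw [ascPochhammer_succ_eval]
    rcases Nat.eq_zero_or_pos k with rfl | hk
    · simp
    · have h1 : (1 : ℝ) ≤ k := by exact_mod_cast hk
      have h0 : 0 < min a 1 := by positivity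
      nlinarith

theorem ascPochhammer_succ_eval_eq_mul (a : ℝ) (k : ℕ) :
    (ascPochhammer ℝ (k + 1)).eval a = a * (ascPochhammer ℝ k).eval (a + 1) := by
  rw [ascPochhammer_succ_left]
  simp

theorem norm_hypZeroOne_term_le {a : ℝ} (ha : 0 < a) (v : ℝ) (k : ℕ) :
    ‖v ^ k / (k.factorial * (ascPochhammer ℝ k).eval a)‖
      ≤ (min a 1)⁻¹ * (|v| ^ k / k.factorial) := by
  have h := min_le_ascPochhammer_eval ha k
  have h0 : 0 < min a 1 := by positivity
  have h1 : 0 < (ascPochhammer ℝ k).eval a := h0.trans_le h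
  rw [norm_div, norm_pow, norm_mul, Real.norm_natCast, Real.norm_eq_abs, Real.norm_eq_abs,
    abs_of_pos h1, div_mul_eq_div_div, div_eq_inv_mul _ (Polynomial.eval _ _)]
  gcongr

theorem summable_hypZeroOne {a : ℝ} (ha : 0 < a) (v : ℝ) :
    Summable fun k : ℕ => v ^ k / (k.factorial * (ascPochhammer ℝ k).eval a) :=
  .of_norm_bounded ((Real.summable_pow_div_factorial |v|).mul_left _) (norm_hypZeroOne_term_le ha v)

theorem hypZeroOne_term_succ {a : ℝ} (k : ℕ) (v : ℝ) :
    ((k + 1 : ℕ) : ℝ) * v ^ k / ((k + 1).factorial * (ascPochhammer ℝ (k + 1)).eval a)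
      = a⁻¹ * (v ^ k / (k.factorial * (ascPochhammer ℝ k).eval (a + 1))) := by
  rw [ascPochhammer_succ_eval_eq_mul, Nat.factorial_succ]
  push_cast
  have : (k : ℝ) + 1 ≠ 0 := by positivity
  rw [mul_assoc, mul_div_mul_left _ _ this, div_eq_mul_inv, div_eq_mul_inv]
  simp only [mul_inv]
  ring

theorem hasDerivAt_hypZeroOne {a : ℝ} (ha : 0 < a) (v : ℝ) :
    HasDerivAt (hypZeroOne a) (hypZeroOne (a + 1) v / a) v := by
  have key := hasDerivAt_tsum_of_isPreconnected
    (g := fun (k : ℕ) (w : ℝ) => w ^ k / (k.factorial * (ascPochhammer ℝ k).eval a))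
    (g' := fun (k : ℕ) w => (k : ℝ) * w ^ (k - 1) / (k.factorial * (ascPochhammer ℝ k).eval a))
    (u := fun k : ℕ => (k : ℝ) * (|v| + 1) ^ (k - 1) / (k.factorial * (ascPochhammer ℝ k).eval a))
    (t := Metric.ball 0 (|v| + 1)) (y₀ := v) (y := v) ?_ Metric.isOpen_ball
    (convex_ball _ _).isPreconnected ?_ ?_ (by simp) (summable_hypZeroOne ha v) (by simp)
  · refine key.congr_deriv ?_
    rw [tsum_eq_zero_add']
    · simp only [Nat.add_sub_cancel, hypZeroOne_term_succ, tsum_mul_left]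
      simp [hypZeroOne, div_eq_inv_mul]
    · simp only [Nat.add_sub_cancel, hypZeroOne_term_succ]
      exact (summable_hypZeroOne (by linarith) v).mul_left _
  · rw [← summable_nat_add_iff 1]
    simp only [Nat.add_sub_cancel, hypZeroOne_term_succ]
    exact (summable_hypZeroOne (by linarith) _).mul_left _
  · intro k w _
    exact (hasDerivAt_pow k w).div_const _
  · intro k w hw
    have hw' : |w| ≤ |v| + 1 := by simpa using (mem_ball_zero_iff.1 hw).le
    have h1 : 0 < (ascPochhammer ℝ k).eval a := ascPochhammer_pos k a ha
    rw [norm_div, norm_mul, norm_mul, norm_pow, Real.norm_eq_abs w, Real.norm_natCast,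
      Real.norm_natCast, Real.norm_eq_abs, abs_of_pos h1]
    gcongr

theorem one_le_hypZeroOne {a v : ℝ} (ha : 0 < a) (hv : 0 ≤ v) : 1 ≤ hypZeroOne a v := by
  have := (summable_hypZeroOne ha v).le_tsum 0 fun k _ => by
    have h1 := ascPochhammer_pos k a ha
    positivity
  simpa [hypZeroOne] using this

theorem ascPochhammer_eval_add_one {a : ℝ} (ha : 0 < a) (k : ℕ) :
    (ascPochhammer ℝ k).eval (a + 1) = (ascPochhammer ℝ k).eval a * ((a + k) / a) := by
  have h := ascPochhammer_succ_eval_eq_mul a k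
  rw [ascPochhammer_succ_eval] at h
  field_simp
  linarith

/-- The ratio `₀F₁(; a + 1; v) / ₀F₁(; a; v)` decreases in `v ≥ 0`. -/
theorem hypZeroOne_ratio_antitone {a u v : ℝ} (ha : 0 < a) (hu : 0 ≤ u) (huv : u ≤ v) :
    hypZeroOne (a + 1) v * hypZeroOne a u ≤ hypZeroOne (a + 1) u * hypZeroOne a v := by
  set c : ℕ → ℝ := fun k => (k.factorial * (ascPochhammer ℝ k).eval a)⁻¹ with hc
  have hcpos : ∀ k, 0 < c k := fun k => by
    have h1 := ascPochhammer_pos k a ha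
    positivity
  have hS : ∀ b w : ℝ, 0 < b → 0 ≤ w → Summable fun k : ℕ =>
      ‖w ^ k / (k.factorial * (ascPochhammer ℝ k).eval b)‖ := fun b w hb hw =>
    (summable_hypZeroOne hb w).norm
  have hv := hu.trans huv
  have ha1 : 0 < a + 1 := by linarith
  have e1 := tsum_mul_tsum_of_summable_norm (hS (a + 1) v ha1 hv) (hS a u ha hu)
  have e2 := tsum_mul_tsum_of_summable_norm (hS (a + 1) u ha1 hu) (hS a v ha hv)
  have s1 := summable_mul_of_summable_norm (hS (a + 1) v ha1 hv) (hS a u ha hu)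
  have s2 := summable_mul_of_summable_norm (hS (a + 1) u ha1 hu) (hS a v ha hv)
  rw [hypZeroOne, hypZeroOne, hypZeroOne, hypZeroOne, e1, e2, ← sub_nonneg, ← s2.tsum_sub s1]
  set A : ℕ × ℕ → ℝ := fun z => _ with hA
  have sA : Summable A := s2.sub s1
  change 0 ≤ ∑' z, A z
  have hsw : ∑' z, A z = ∑' z : ℕ × ℕ, A z.swap := ((Equiv.prodComm ℕ ℕ).tsum_eq A).symm
  have sA' : Summable fun z : ℕ × ℕ => A z.swap := (Equiv.prodComm ℕ ℕ).summable_iff.2 sA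
  -- Single terms of the double sum have no fixed sign; pairing `(j, k)` with `(k, j)` gives a
  -- product of two factors that change sign together as `j` passes `k`.
  suffices 0 ≤ ∑' z, (A z + A z.swap) by
    rw [sA.tsum_add sA', ← hsw] at this
    linarith
  refine tsum_nonneg fun ⟨j, k⟩ => ?_
  have hform : A (j, k) + A (k, j) =
      c j * c k * (a / (a + j) - a / (a + k)) * (u ^ j * v ^ k - v ^ j * u ^ k) := by
    simp only [hA, hc, ascPochhammer_eval_add_one ha]
    have h1 := ascPochhammer_pos k a ha
    have h2 := ascPochhammer_pos j a ha
    have h3 : (0 : ℝ) < a + j := by positivity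
    have h4 : (0 : ℝ) < a + k := by positivity
    field_simp
    ring
  have hmono : ∀ i l : ℕ, i ≤ l → 0 ≤ (a / (a + i) - a / (a + l)) ∧
      0 ≤ u ^ i * v ^ l - v ^ i * u ^ l := by
    intro i l hil
    have hil' : (i : ℝ) ≤ l := by exact_mod_cast hil
    constructor
    · rw [sub_nonneg]
      gcongr
    · obtain ⟨d, rfl⟩ := Nat.exists_eq_add_of_le hil
      have : u ^ d ≤ v ^ d := by gcongr
      have h5 : 0 ≤ u ^ i * v ^ i := by positivity
      rw [pow_add, pow_add]
      nlinarith
  rw [Prod.swap_prod_mk, hform, mul_assoc]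
  refine mul_nonneg (mul_pos (hcpos j) (hcpos k)).le ?_
  rcases le_total j k with h | h
  · exact mul_nonneg (hmono j k h).1 (hmono j k h).2
  · refine mul_nonneg_of_nonpos_of_nonpos ?_ ?_
    · linarith [(hmono k j h).1]
    · linarith [(hmono k j h).2, mul_comm (u ^ k) (v ^ j), mul_comm (v ^ k) (u ^ j)]

/-- `log ₀F₁(; a; ·)` is concave on `[0, ∞)`, in tangent form. -/
theorem hypZeroOne_le_mul_exp {a u v : ℝ} (ha : 0 < a) (hu : 0 ≤ u) (hv : 0 ≤ v) :
    hypZeroOne a v ≤ hypZeroOne a u *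
      Real.exp (hypZeroOne (a + 1) u / (a * hypZeroOne a u) * (v - u)) := by
  have hFu : 0 < hypZeroOne a u := one_pos.trans_le (one_le_hypZeroOne ha hu)
  set κ := hypZeroOne (a + 1) u / (a * hypZeroOne a u) with hκ
  set φ : ℝ → ℝ := fun w => hypZeroOne a w * Real.exp (-(κ * w)) with hφ
  have hd : ∀ w, HasDerivAt φ ((hypZeroOne (a + 1) w / a - κ * hypZeroOne a w) *
      Real.exp (-(κ * w))) w := fun w => by
    refine ((hasDerivAt_hypZeroOne ha w).mul
      (((hasDerivAt_id w).const_mul κ).neg.exp)).congr_deriv ?_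
    simp
    ring
  have hc : Continuous φ := continuous_iff_continuousAt.2 fun w => (hd w).continuousAt
  have hfac : ∀ w, hypZeroOne (a + 1) w / a - κ * hypZeroOne a w =
      (hypZeroOne (a + 1) w * hypZeroOne a u - hypZeroOne (a + 1) u * hypZeroOne a w) /
        (a * hypZeroOne a u) := fun w => by
    rw [hκ]
    field_simp
  -- `κ` is the logarithmic derivative at `u`. As the ratio decreases, `φ` rises on `[0, u]` and
  -- falls beyond, so it peaks at `u`.
  have hle : φ v ≤ φ u := by
    rcases le_total u v with h | h
    · refine antitoneOn_of_deriv_nonpos (convex_Ici u) hc.continuousOn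
        (fun w _ => (hd w).differentiableAt.differentiableWithinAt) (fun w hw => ?_)
        (Set.mem_Ici.2 le_rfl) h h
      rw [interior_Ici] at hw
      rw [(hd w).deriv, hfac]
      refine mul_nonpos_of_nonpos_of_nonneg (div_nonpos_of_nonpos_of_nonneg ?_ (by positivity))
        (Real.exp_pos _).le
      exact sub_nonpos.2 (hypZeroOne_ratio_antitone ha hu (le_of_lt hw))
    · refine monotoneOn_of_deriv_nonneg (convex_Icc 0 u) hc.continuousOn
        (fun w _ => (hd w).differentiableAt.differentiableWithinAt) (fun w hw => ?_)
        ⟨hv, h⟩ ⟨hu, le_rfl⟩ h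
      rw [interior_Icc] at hw
      rw [(hd w).deriv, hfac]
      refine mul_nonneg (div_nonneg ?_ (by positivity)) (Real.exp_pos _).le
      exact sub_nonneg.2 (hypZeroOne_ratio_antitone ha hw.1.le hw.2.le)
  have h2 := mul_le_mul_of_nonneg_right hle (Real.exp_pos (κ * v)).le
  simp only [hφ, mul_assoc, ← Real.exp_add] at h2
  rw [show κ * (v - u) = -(κ * u) + κ * v by ring]
  simpa using h2

/-! ### Polar coordinates -/

theorem integral_sphereUniform (n : ℕ)
    (f : Metric.sphere (0 : EuclideanSpace ℝ (Fin n)) 1 → ℝ) :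
    ∫ l, f l ∂(sphereUniform n) =
      ((volume : Measure (EuclideanSpace ℝ (Fin n))).toSphere.real Set.univ)⁻¹ *
        ∫ l, f l ∂(volume : Measure (EuclideanSpace ℝ (Fin n))).toSphere := by
  rw [sphereUniform, integral_smul_measure, ENNReal.toReal_inv, smul_eq_mul]
  rfl

theorem integral_eq_integral_prod_toSphere {n : ℕ} (hn : 1 ≤ n)
    (h : EuclideanSpace ℝ (Fin n) → ℝ) :
    ∫ y, h y = ∫ z, h ((z.2 : ℝ) • (z.1 : EuclideanSpace ℝ (Fin n)))
      ∂((volume : Measure (EuclideanSpace ℝ (Fin n))).toSphere.prod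
        (Measure.volumeIoiPow (Module.finrank ℝ (EuclideanSpace ℝ (Fin n)) - 1))) := by
  have : NeZero n := ⟨by omega⟩
  have h1 := (volume : Measure (EuclideanSpace ℝ (Fin n))).measurePreserving_homeomorphUnitSphereProd.integral_comp
    (Homeomorph.measurableEmbedding _)
    (fun z : Metric.sphere (0 : EuclideanSpace ℝ (Fin n)) 1 × Set.Ioi (0 : ℝ) => h ((z.2 : ℝ) • (z.1 : EuclideanSpace ℝ (Fin n))))
  have h2 := integral_subtype_comap (μ := volume)
    (measurableSet_singleton (0 : EuclideanSpace ℝ (Fin n))).compl h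
  rw [restrict_compl_singleton] at h2
  rw [← h1, ← h2]
  refine integral_congr_ae (.of_forall fun y : ({0}ᶜ : Set (EuclideanSpace ℝ (Fin n))) => ?_)
  have hy : ‖(y : EuclideanSpace ℝ (Fin n))‖ ≠ 0 := norm_ne_zero_iff.2 y.2
  simp [smul_smul, hy]

theorem integrable_prod_toSphere {n : ℕ} (hn : 1 ≤ n)
    {h : EuclideanSpace ℝ (Fin n) → ℝ} (hh : Integrable h) :
    Integrable (fun z : Metric.sphere (0 : EuclideanSpace ℝ (Fin n)) 1 × Set.Ioi (0 : ℝ) =>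
        h ((z.2 : ℝ) • (z.1 : EuclideanSpace ℝ (Fin n))))
      ((volume : Measure (EuclideanSpace ℝ (Fin n))).toSphere.prod
        (Measure.volumeIoiPow (Module.finrank ℝ (EuclideanSpace ℝ (Fin n)) - 1))) := by
  have : NeZero n := ⟨by omega⟩
  rw [← (volume : Measure (EuclideanSpace ℝ (Fin n))).measurePreserving_homeomorphUnitSphereProd.integrable_comp_emb
    (Homeomorph.measurableEmbedding _)]
  rw [← restrict_compl_singleton (μ := volume) (0 : EuclideanSpace ℝ (Fin n)), ← IntegrableOn,
    integrableOn_iff_comap_subtypeVal (measurableSet_singleton _).compl] at hh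
  refine hh.congr (.of_forall fun y => ?_)
  have hy : ‖(y : EuclideanSpace ℝ (Fin n))‖ ≠ 0 := norm_ne_zero_iff.2 y.2
  simp [smul_smul, hy]

/-- Averaging an integrable function over spheres centred at the origin preserves its integral. -/
theorem integral_eq_integral_sphere_average {n : ℕ} (hn : 1 ≤ n)
    {h : EuclideanSpace ℝ (Fin n) → ℝ} (hh : Integrable h) :
    ∫ y, h y = ∫ y : EuclideanSpace ℝ (Fin n),
      ∫ l, h (‖y‖ • (l : EuclideanSpace ℝ (Fin n))) ∂(sphereUniform n) := by
  have : NeZero n := ⟨by omega⟩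
  rw [integral_eq_integral_prod_toSphere hn h, integral_eq_integral_prod_toSphere hn,
    integral_prod_symm _ (integrable_prod_toSphere hn hh)]
  have hS : (volume : Measure (EuclideanSpace ℝ (Fin n))).toSphere.real Set.univ ≠ 0 := by
    rw [Measure.real, ENNReal.toReal_ne_zero]
    exact ⟨by rw [Ne, Measure.measure_univ_eq_zero]; exact Measure.toSphere_ne_zero _,
      measure_ne_top _ _⟩
  have h2 : ∀ z : Metric.sphere (0 : EuclideanSpace ℝ (Fin n)) 1 × Set.Ioi (0 : ℝ),
      ‖(z.2 : ℝ) • (z.1 : EuclideanSpace ℝ (Fin n))‖ = z.2 := fun z => by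
    have : (0 : ℝ) < z.2 := z.2.2
    simp [norm_smul, abs_of_pos this]
  simp only [h2]
  -- The averaged integrand is radial, so the sphere contributes only its total mass, which cancels
  -- the normalization.
  rw [integral_fun_snd (fun r : Set.Ioi (0 : ℝ) =>
    ∫ l, h ((r : ℝ) • (l : EuclideanSpace ℝ (Fin n))) ∂(sphereUniform n)), smul_eq_mul,
    ← integral_const_mul]
  refine integral_congr_ae (.of_forall fun r => ?_)
  simp only [integral_sphereUniform]
  rw [mul_inv_cancel_left₀ hS]

/-! ### Gaussian integrals -/

theorem ofReal_exp_inner_sub_mul_sq_norm {n : ℕ} (b : ℝ) (x y : EuclideanSpace ℝ (Fin n)) :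
    ((Real.exp (inner ℝ y x - b * ‖y‖ ^ 2) : ℝ) : ℂ) =
      Complex.exp (-(b : ℂ) * (‖y‖ : ℂ) ^ 2 + 1 * ((inner ℝ x y : ℝ) : ℂ)) := by
  rw [real_inner_comm]
  push_cast
  ring_nf

theorem integral_exp_inner_sub_mul_sq_norm {n : ℕ} {b : ℝ} (hb : 0 < b)
    (x : EuclideanSpace ℝ (Fin n)) :
    ∫ y, Real.exp (inner ℝ y x - b * ‖y‖ ^ 2) =
      (Real.pi / b) ^ ((n : ℝ) / 2) * Real.exp (‖x‖ ^ 2 / (4 * b)) := by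
  have h := GaussianFourier.integral_cexp_neg_mul_sq_norm_add (show 0 < (b : ℂ).re from hb) 1 x
  have hp : (0 : ℝ) ≤ Real.pi / b := by positivity
  rw [← Complex.ofReal_inj, ← integral_complex_ofReal]
  simp only [ofReal_exp_inner_sub_mul_sq_norm]
  rw [h, Complex.ofReal_mul, Complex.ofReal_cpow hp]
  simp

theorem integrable_exp_inner_sub_mul_sq_norm {n : ℕ} {b : ℝ} (hb : 0 < b)
    (x : EuclideanSpace ℝ (Fin n)) :
    Integrable fun y => Real.exp (inner ℝ y x - b * ‖y‖ ^ 2) := by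
  refine (GaussianFourier.integrable_cexp_neg_mul_sq_norm_add
    (show 0 < (b : ℂ).re from hb) 1 x).re.congr (.of_forall fun y => ?_)
  simp only [← ofReal_exp_inner_sub_mul_sq_norm]
  exact Complex.ofReal_re _

theorem integral_norm_pow_mul_exp_neg_sq {n : ℕ} (hn : 1 ≤ n) (m : ℕ) :
    ∫ y : EuclideanSpace ℝ (Fin n), ‖y‖ ^ m * Real.exp (-‖y‖ ^ 2) =
      n * (volume : Measure (EuclideanSpace ℝ (Fin n))).real (Metric.ball 0 1) *
        (Real.Gamma (((n : ℝ) + m) / 2) / 2) := by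
  have : NeZero n := ⟨by omega⟩
  rw [integral_fun_norm_addHaar volume (fun r => r ^ m * Real.exp (-r ^ 2))]
  have h := integral_rpow_mul_exp_neg_rpow (p := 2) (q := (n - 1 + m : ℕ)) two_pos
    (by have : (0 : ℝ) ≤ (n - 1 + m : ℕ) := Nat.cast_nonneg _
        linarith)
  simp only [finrank_euclideanSpace, Fintype.card_fin, nsmul_eq_mul, smul_eq_mul, mul_assoc]
  congr 2
  rw [show ((n : ℝ) + m) / 2 = ((n - 1 + m : ℕ) + 1 : ℝ) / 2 by
    push_cast [Nat.cast_sub hn]; ring, div_eq_inv_mul, ← one_div, ← h]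
  refine setIntegral_congr_fun measurableSet_Ioi fun r _ => ?_
  simp only [Real.rpow_natCast, Real.rpow_two]
  ring

/-- Differentiate `f' = 2 c t f` repeatedly. At `t = 0` only the last term survives, which yields a
two-step recurrence for Gaussian moments. -/
theorem iteratedDeriv_add_two_mul_exp_sq (C c : ℝ) (m : ℕ) (t : ℝ) :
    iteratedDeriv (m + 2) (fun s => C * Real.exp (c * s ^ 2)) t =
      2 * c * t * iteratedDeriv (m + 1) (fun s => C * Real.exp (c * s ^ 2)) t +
        2 * c * (m + 1) * iteratedDeriv m (fun s => C * Real.exp (c * s ^ 2)) t := by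
  set f : ℝ → ℝ := fun s => C * Real.exp (c * s ^ 2) with hf
  have hsm : ContDiff ℝ ⊤ f := by fun_prop
  have hD : ∀ k s, HasDerivAt (iteratedDeriv k f) (iteratedDeriv (k + 1) f s) s := fun k s => by
    rw [iteratedDeriv_succ]
    exact (hsm.differentiable_iteratedDeriv k (by exact_mod_cast WithTop.coe_lt_top _) s).hasDerivAt
  have h1 : ∀ s, iteratedDeriv 1 f s = 2 * c * s * f s := fun s => by
    rw [iteratedDeriv_one]
    have := (((hasDerivAt_pow 2 s).const_mul c).exp.const_mul C).deriv
    rw [hf, this]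
    simp
    ring
  induction m generalizing t with
  | zero =>
    have h2 : iteratedDeriv (0 + 1) f = fun s => 2 * c * s * f s := funext h1
    rw [show 0 + 2 = (0 + 1) + 1 from rfl, iteratedDeriv_succ, h2]
    have h0 := hD 0 t
    rw [iteratedDeriv_zero, zero_add, h1] at h0
    refine (((hasDerivAt_id t).const_mul (2 * c)).mul h0).deriv.trans ?_
    simp
    ring
  | succ m ih =>
    rw [show m + 1 + 2 = (m + 2) + 1 from rfl, iteratedDeriv_succ, funext ih]
    refine ((((hasDerivAt_id t).const_mul (2 * c)).mul (hD (m + 1) t)).add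
      ((hD m t).const_mul (2 * c * (m + 1)))).deriv.trans ?_
    simp only [id, ih]
    push_cast
    ring

/-! ### Moments of a linear form: Gaussian and spherical -/

/-- The measure on `ℝⁿ` with density `exp (-‖y‖²)`. -/
noncomputable def gaussWeight (n : ℕ) : Measure (EuclideanSpace ℝ (Fin n)) :=
  volume.withDensity fun y => ENNReal.ofReal (Real.exp (-‖y‖ ^ 2))

theorem integral_gaussWeight (n : ℕ) (f : EuclideanSpace ℝ (Fin n) → ℝ) :
    ∫ y, f y ∂(gaussWeight n) = ∫ y, f y * Real.exp (-‖y‖ ^ 2) := by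
  rw [gaussWeight, integral_withDensity_eq_integral_toReal_smul (by fun_prop) (by simp)]
  refine integral_congr_ae (.of_forall fun y => ?_)
  simp only [ENNReal.toReal_ofReal (Real.exp_pos _).le, smul_eq_mul, mul_comm]

theorem integrable_gaussWeight_iff (n : ℕ) (f : EuclideanSpace ℝ (Fin n) → ℝ) :
    Integrable f (gaussWeight n) ↔ Integrable fun y => f y * Real.exp (-‖y‖ ^ 2) := by
  rw [gaussWeight, integrable_withDensity_iff_integrable_smul' (by fun_prop) (by simp)]
  refine integrable_congr (.of_forall fun y => ?_)
  simp only [ENNReal.toReal_ofReal (Real.exp_pos _).le, smul_eq_mul, mul_comm]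

theorem integrableExpSet_inner_gaussWeight (n : ℕ) (x : EuclideanSpace ℝ (Fin n)) :
    ProbabilityTheory.integrableExpSet (fun y => inner ℝ y x) (gaussWeight n) = Set.univ := by
  refine Set.eq_univ_of_forall fun t => ?_
  change Integrable _ _
  rw [integrable_gaussWeight_iff]
  refine (integrable_exp_inner_sub_mul_sq_norm one_pos (t • x)).congr (.of_forall fun y => ?_)
  simp only [← Real.exp_add, inner_smul_right]
  ring_nf

theorem mgf_inner_gaussWeight (n : ℕ) (x : EuclideanSpace ℝ (Fin n)) :
    ProbabilityTheory.mgf (fun y => inner ℝ y x) (gaussWeight n) =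
      fun t => Real.pi ^ ((n : ℝ) / 2) * Real.exp (‖x‖ ^ 2 / 4 * t ^ 2) := by
  funext t
  have h := integral_exp_inner_sub_mul_sq_norm one_pos (t • x)
  rw [ProbabilityTheory.mgf, integral_gaussWeight]
  simp only [← Real.exp_add]
  convert h using 2
  · simp only [inner_smul_right]; ring_nf
  · simp
  · rw [norm_smul, mul_pow, Real.norm_eq_abs, sq_abs]; ring_nf

theorem integral_inner_pow_gaussWeight (n m : ℕ) (x : EuclideanSpace ℝ (Fin n)) :
    ∫ y, (inner ℝ y x) ^ m ∂(gaussWeight n) =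
      iteratedDeriv m (fun t => Real.pi ^ ((n : ℝ) / 2) * Real.exp (‖x‖ ^ 2 / 4 * t ^ 2)) 0 := by
  rw [← mgf_inner_gaussWeight, ProbabilityTheory.iteratedDeriv_mgf_zero
    (by simp [integrableExpSet_inner_gaussWeight])]
  rfl

theorem integral_inner_gaussWeight (n : ℕ) (x : EuclideanSpace ℝ (Fin n)) :
    ∫ y, inner ℝ y x ∂(gaussWeight n) = 0 := by
  have h := integral_neg_eq_self (fun y : EuclideanSpace ℝ (Fin n) =>
    inner ℝ y x * Real.exp (-‖y‖ ^ 2)) volume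
  simp only [inner_neg_left, norm_neg, neg_mul, integral_neg] at h
  rw [integral_gaussWeight]
  linarith

theorem integrable_inner_pow_gaussWeight (n m : ℕ) (x : EuclideanSpace ℝ (Fin n)) :
    Integrable (fun y => (inner ℝ y x) ^ m) (gaussWeight n) :=
  ProbabilityTheory.integrable_pow_of_mem_interior_integrableExpSet
    (by simp [integrableExpSet_inner_gaussWeight]) m

/-- The weight is radial and the form homogeneous of degree `m`, so the moment factors in polar
coordinates. -/
theorem integral_inner_pow_gaussWeight_eq_mul {n : ℕ} (hn : 1 ≤ n) (m : ℕ)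
    (x : EuclideanSpace ℝ (Fin n)) :
    ∫ y, (inner ℝ y x) ^ m ∂(gaussWeight n) =
      (∫ l, (inner ℝ (l : EuclideanSpace ℝ (Fin n)) x) ^ m ∂(sphereUniform n)) *
        ∫ y : EuclideanSpace ℝ (Fin n), ‖y‖ ^ m * Real.exp (-‖y‖ ^ 2) := by
  have h := (integrable_gaussWeight_iff n _).1 (integrable_inner_pow_gaussWeight n m x)
  rw [integral_gaussWeight, integral_eq_integral_sphere_average hn h, ← integral_const_mul]
  refine integral_congr_ae (.of_forall fun y => ?_)
  have h2 : ∀ l : Metric.sphere (0 : EuclideanSpace ℝ (Fin n)) 1,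
      ‖‖y‖ • (l : EuclideanSpace ℝ (Fin n))‖ = ‖y‖ := fun l => by simp [norm_smul]
  simp only [h2, real_inner_smul_left, mul_pow]
  rw [← integral_mul_const]
  refine integral_congr_ae (.of_forall fun l => ?_)
  simp only
  ring

theorem integral_norm_pow_mul_exp_neg_sq_pos {n : ℕ} (hn : 1 ≤ n) (m : ℕ) :
    0 < ∫ y : EuclideanSpace ℝ (Fin n), ‖y‖ ^ m * Real.exp (-‖y‖ ^ 2) := by
  have : NeZero n := ⟨by omega⟩
  rw [integral_norm_pow_mul_exp_neg_sq hn]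
  have h1 : 0 < (volume : Measure (EuclideanSpace ℝ (Fin n))).real (Metric.ball 0 1) :=
    ENNReal.toReal_pos (Metric.measure_ball_pos _ _ one_pos).ne' measure_ball_lt_top.ne
  have h2 : (0 : ℝ) < n := by exact_mod_cast hn
  have h3 := Real.Gamma_pos_of_pos (show 0 < ((n : ℝ) + m) / 2 by positivity)
  positivity

theorem integral_norm_pow_add_two_mul_exp_neg_sq {n : ℕ} (hn : 1 ≤ n) (m : ℕ) :
    ∫ y : EuclideanSpace ℝ (Fin n), ‖y‖ ^ (m + 2) * Real.exp (-‖y‖ ^ 2) =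
      ((n : ℝ) + m) / 2 * ∫ y : EuclideanSpace ℝ (Fin n), ‖y‖ ^ m * Real.exp (-‖y‖ ^ 2) := by
  have h2 : (0 : ℝ) < n := by exact_mod_cast hn
  rw [integral_norm_pow_mul_exp_neg_sq hn, integral_norm_pow_mul_exp_neg_sq hn,
    show ((n : ℝ) + (m + 2 : ℕ)) / 2 = ((n : ℝ) + m) / 2 + 1 by push_cast; ring,
    Real.Gamma_add_one (by positivity)]
  ring

/-- The recurrence for the moments of a linear form on the sphere. -/
theorem sphereUniform_moment_add_two {n : ℕ} (hn : 1 ≤ n) (m : ℕ) (x : EuclideanSpace ℝ (Fin n)) :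
    (∫ l, (inner ℝ (l : EuclideanSpace ℝ (Fin n)) x) ^ (m + 2) ∂(sphereUniform n)) * (n + m) =
      (m + 1) * ‖x‖ ^ 2 *
        ∫ l, (inner ℝ (l : EuclideanSpace ℝ (Fin n)) x) ^ m ∂(sphereUniform n) := by
  have h := iteratedDeriv_add_two_mul_exp_sq (Real.pi ^ ((n : ℝ) / 2)) (‖x‖ ^ 2 / 4) m 0
  rw [mul_zero, zero_mul, zero_add, ← integral_inner_pow_gaussWeight,
    ← integral_inner_pow_gaussWeight,
    integral_inner_pow_gaussWeight_eq_mul hn, integral_inner_pow_gaussWeight_eq_mul hn m,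
    integral_norm_pow_add_two_mul_exp_neg_sq hn] at h
  refine mul_right_cancel₀ (integral_norm_pow_mul_exp_neg_sq_pos hn m).ne' ?_
  linear_combination 2 * h

theorem sphereUniform_moment_odd {n : ℕ} (hn : 1 ≤ n) (k : ℕ) (x : EuclideanSpace ℝ (Fin n)) :
    ∫ l, (inner ℝ (l : EuclideanSpace ℝ (Fin n)) x) ^ (2 * k + 1) ∂(sphereUniform n) = 0 := by
  have h2 : (0 : ℝ) < n := by exact_mod_cast hn
  induction k with
  | zero =>
    have h := integral_inner_pow_gaussWeight_eq_mul hn 1 x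
    simp only [pow_one, integral_inner_gaussWeight] at h
    have h1 := integral_norm_pow_mul_exp_neg_sq_pos hn 1
    simp only [pow_one] at h1
    simpa [h1.ne'] using h.symm
  | succ k ih =>
    have h := sphereUniform_moment_add_two hn (2 * k + 1) x
    rw [ih, mul_zero] at h
    exact (mul_eq_zero.1 h).resolve_right (by positivity)

theorem sphereUniform_moment_even {n : ℕ} (hn : 1 ≤ n) (k : ℕ) (x : EuclideanSpace ℝ (Fin n)) :
    (∫ l, (inner ℝ (l : EuclideanSpace ℝ (Fin n)) x) ^ (2 * k) ∂(sphereUniform n)) /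
        (2 * k).factorial =
      (‖x‖ ^ 2 / 4) ^ k / (k.factorial * (ascPochhammer ℝ k).eval ((n : ℝ) / 2)) := by
  have h2 : (0 : ℝ) < n := by exact_mod_cast hn
  have := isProbabilityMeasure_sphereUniform hn
  induction k with
  | zero => simp
  | succ k ih =>
    have h := sphereUniform_moment_add_two hn (2 * k) x
    rw [show 2 * (k + 1) = 2 * k + 2 by ring, Nat.factorial_succ (2 * k + 1),
      Nat.factorial_succ (2 * k), Nat.factorial_succ k, ascPochhammer_succ_eval, pow_succ]
    have hp := ascPochhammer_pos k ((n : ℝ) / 2) (by positivity)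
    rw [div_eq_div_iff (by positivity) (by positivity)] at ih ⊢
    push_cast at h ⊢
    linear_combination (k.factorial * (k + 1) * (ascPochhammer ℝ k).eval ((n : ℝ) / 2) / 2) * h +
      (2 * k + 1) * (k + 1) * ‖x‖ ^ 2 / 2 * ih

/-! ### The lower bound for `Φ_n` -/

/-- Integrate the exponential series termwise: odd moments vanish and the even ones are the terms of
`₀F₁`. -/
theorem energyPhi_eq_hypZeroOne {n : ℕ} (hn : 1 ≤ n) (x : EuclideanSpace ℝ (Fin n)) :
    energyPhi n x = hypZeroOne ((n : ℝ) / 2) (‖x‖ ^ 2 / 4) := by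
  have := isProbabilityMeasure_sphereUniform hn
  have hb : ∀ (m : ℕ) (l : Metric.sphere (0 : EuclideanSpace ℝ (Fin n)) 1),
      ‖(inner ℝ (l : EuclideanSpace ℝ (Fin n)) x) ^ m / m.factorial‖ ≤ ‖x‖ ^ m / m.factorial :=
    fun m l => by
      rw [norm_div, norm_pow, Real.norm_natCast]
      gcongr
      simpa using norm_inner_le_norm (𝕜 := ℝ) (l : EuclideanSpace ℝ (Fin n)) x
  have hint : ∀ m : ℕ, Integrable (fun l : Metric.sphere (0 : EuclideanSpace ℝ (Fin n)) 1 =>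
      (inner ℝ (l : EuclideanSpace ℝ (Fin n)) x) ^ m / m.factorial) (sphereUniform n) := fun m =>
    .of_bound (by fun_prop) (‖x‖ ^ m / m.factorial) (.of_forall (hb m))
  have hs := hasSum_integral_of_summable_integral_norm hint
    (.of_nonneg_of_le (fun m => integral_nonneg fun l => norm_nonneg _)
      (fun m => (integral_mono (hint m).norm (integrable_const _) (hb m)).trans_eq (by simp))
      (Real.summable_pow_div_factorial ‖x‖))
  have he : ∀ t : ℝ, ∑' m : ℕ, t ^ m / m.factorial = Real.exp t := fun t => by
    rw [Real.exp_eq_exp_ℝ, NormedSpace.exp_eq_tsum_div]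
  simp only [he, integral_div] at hs
  rw [← (mul_right_injective₀ (two_ne_zero (α := ℕ))).hasSum_iff] at hs
  · simp only [Function.comp_def, sphereUniform_moment_even hn] at hs
    exact hs.tsum_eq.symm
  · intro m hm
    obtain ⟨k, rfl⟩ : Odd m := by
      rw [← Nat.not_even_iff_odd]
      rintro ⟨k, rfl⟩
      exact hm ⟨k, by simp only; ring⟩
    rw [sphereUniform_moment_odd hn, zero_div]

/-- Log-concavity of `u ↦ Φ_n (√u x)`, in tangent form at `u = 1`. -/
theorem exists_energyPhi_smul_le {n : ℕ} (hn : 1 ≤ n) {x : EuclideanSpace ℝ (Fin n)} (hx : x ≠ 0) :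
    ∃ c : ℝ, 0 < c ∧ ∀ r : ℝ,
      energyPhi n (r • x) ≤ energyPhi n x * Real.exp (c * (r ^ 2 - 1)) := by
  have h2 : (0 : ℝ) < n := by exact_mod_cast hn
  have hx' : 0 < ‖x‖ := norm_pos_iff.2 hx
  have hu : 0 ≤ ‖x‖ ^ 2 / 4 := by positivity
  have h3 : 0 < hypZeroOne ((n : ℝ) / 2) (‖x‖ ^ 2 / 4) :=
    one_pos.trans_le (one_le_hypZeroOne (by positivity) hu)
  have h4 : 0 < hypZeroOne ((n : ℝ) / 2 + 1) (‖x‖ ^ 2 / 4) :=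
    one_pos.trans_le (one_le_hypZeroOne (by positivity) hu)
  -- With `u = ‖x‖²/4`, this is `u` times the logarithmic derivative at `u`, since `‖r • x‖²/4 - u =
  -- u (r² - 1)`.
  refine ⟨hypZeroOne ((n : ℝ) / 2 + 1) (‖x‖ ^ 2 / 4) /
    ((n : ℝ) / 2 * hypZeroOne ((n : ℝ) / 2) (‖x‖ ^ 2 / 4)) * (‖x‖ ^ 2 / 4), by positivity,
    fun r => ?_⟩
  have h := hypZeroOne_le_mul_exp (a := (n : ℝ) / 2) (by positivity) hu
    (show 0 ≤ ‖r • x‖ ^ 2 / 4 by positivity)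
  rw [energyPhi_eq_hypZeroOne hn, energyPhi_eq_hypZeroOne hn]
  refine h.trans_eq ?_
  rw [norm_smul, mul_pow, Real.norm_eq_abs, sq_abs]
  congr 2
  ring

/-- The Gaussian average of `Φ_n`, bounded through the tangent inequality. -/
theorem exp_le_energyPhi_mul {n : ℕ} (hn : 1 ≤ n) {x : EuclideanSpace ℝ (Fin n)} {b c : ℝ}
    (hb : 0 < b) (hcb : c < b)
    (hc : ∀ r : ℝ, energyPhi n (r • x) ≤ energyPhi n x * Real.exp (c * (r ^ 2 - 1))) :
    (Real.pi / b) ^ ((n : ℝ) / 2) * Real.exp (‖x‖ ^ 2 / (4 * b)) ≤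
      energyPhi n x * Real.exp (-c) * (Real.pi / (b - c)) ^ ((n : ℝ) / 2) := by
  have hbc : 0 < b - c := by linarith
  have hg := integral_exp_inner_sub_mul_sq_norm hbc (0 : EuclideanSpace ℝ (Fin n))
  have hgi := integrable_exp_inner_sub_mul_sq_norm hbc (0 : EuclideanSpace ℝ (Fin n))
  simp only [inner_zero_right, zero_sub, norm_zero, ne_eq, OfNat.ofNat_ne_zero, not_false_eq_true,
    zero_pow, zero_div, Real.exp_zero, mul_one] at hg hgi
  rw [← integral_exp_inner_sub_mul_sq_norm hb x, integral_eq_integral_sphere_average hn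
    (integrable_exp_inner_sub_mul_sq_norm hb x), ← hg, ← integral_const_mul]
  have hav : ∀ y : EuclideanSpace ℝ (Fin n),
      ∫ l, Real.exp (inner ℝ (‖y‖ • (l : EuclideanSpace ℝ (Fin n))) x -
        b * ‖‖y‖ • (l : EuclideanSpace ℝ (Fin n))‖ ^ 2) ∂(sphereUniform n) =
      energyPhi n (‖y‖ • x) * Real.exp (-(b * ‖y‖ ^ 2)) := fun y => by
    rw [energyPhi, ← integral_mul_const]
    refine integral_congr_ae (.of_forall fun l => ?_)
    simp only [← Real.exp_add, real_inner_smul_left, inner_smul_right]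
    simp [norm_smul, sub_eq_add_neg]
  simp only [hav]
  refine integral_mono_of_nonneg (.of_forall fun y => ?_) (hgi.const_mul _)
    (.of_forall fun y => ?_)
  · exact mul_nonneg (integral_nonneg fun l => (Real.exp_pos _).le) (Real.exp_pos _).le
  · refine (mul_le_mul_of_nonneg_right (hc ‖y‖) (Real.exp_pos _).le).trans_eq ?_
    simp only [mul_assoc, ← Real.exp_add]
    ring_nf

theorem mainTheorem4 (n : ℕ) (hn : 1 ≤ n) (X : EuclideanSpace ℝ (Fin n)) (lam : ℝ)
    (ε : ℝ) (hε0 : 0 < ε) (hε1 : ε < 1) :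
    energyPhi n (lam • X) ≥
      (1 - ε ^ 2) ^ ((n : ℝ) / 2) * Real.exp (ε * ‖lam • X‖) := by
  generalize lam • X = x
  have hε2 : 0 < 1 - ε ^ 2 := by nlinarith
  rcases eq_or_ne x 0 with rfl | hx
  · rw [energyPhi_eq_hypZeroOne hn, norm_zero, mul_zero, Real.exp_zero, mul_one]
    refine le_trans (Real.rpow_le_one hε2.le (by nlinarith) (by positivity))
      (one_le_hypZeroOne ?_ (by simp))
    have : (0 : ℝ) < n := by exact_mod_cast hn
    positivity
  obtain ⟨c, hc0, hc⟩ := exists_energyPhi_smul_le hn hx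
  -- The choice `b = c / ε²` makes `(b - c) / b = 1 - ε²`.
  have hb : 0 < c / ε ^ 2 := by positivity
  have hcb : c / ε ^ 2 - c = c * (1 - ε ^ 2) / ε ^ 2 := by field_simp
  have hbc : 0 < c / ε ^ 2 - c := by rw [hcb]; positivity
  have h := exp_le_energyPhi_mul hn hb (by linarith) hc
  have hpos : 0 < Real.pi / (c / ε ^ 2 - c) := by positivity
  have hsplit : Real.pi / (c / ε ^ 2) = (1 - ε ^ 2) * (Real.pi / (c / ε ^ 2 - c)) := by
    rw [hcb]
    field_simp
  rw [hsplit, Real.mul_rpow hε2.le hpos.le] at h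
  have h1 : (1 - ε ^ 2) ^ ((n : ℝ) / 2) * Real.exp (‖x‖ ^ 2 / (4 * (c / ε ^ 2))) ≤
      energyPhi n x * Real.exp (-c) :=
    le_of_mul_le_mul_right (by linarith) (Real.rpow_pos_of_pos hpos ((n : ℝ) / 2))
  -- AM-GM: the difference of the two sides is a square over `4c`.
  have h2 : ε * ‖x‖ ≤ ‖x‖ ^ 2 / (4 * (c / ε ^ 2)) + c := by
    have : ‖x‖ ^ 2 / (4 * (c / ε ^ 2)) + c - ε * ‖x‖ = (ε * ‖x‖ - 2 * c) ^ 2 / (4 * c) := by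
      field_simp
      ring
    have h3 : 0 ≤ (ε * ‖x‖ - 2 * c) ^ 2 / (4 * c) := by positivity
    linarith
  calc (1 - ε ^ 2) ^ ((n : ℝ) / 2) * Real.exp (ε * ‖x‖)
      ≤ (1 - ε ^ 2) ^ ((n : ℝ) / 2) *
          (Real.exp (‖x‖ ^ 2 / (4 * (c / ε ^ 2))) * Real.exp c) := by
        rw [← Real.exp_add]
        gcongr
    _ ≤ energyPhi n x * Real.exp (-c) * Real.exp c := by
        rw [← mul_assoc]
        gcongr
    _ = energyPhi n x := by
        rw [mul_assoc, ← Real.exp_add, neg_add_cancel, Real.exp_zero, mul_one]
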